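/- Fix one of the norms $\|\cdot\|=\ell_1,\ell_2,\ell_\infty$ on $\mathbb{R}^d$. In \textsc{VarianceReduction} there are $n\ge 1$ machines; machine $v$ receives a random vector $x_v\in\mathbb{R}^d$, the $x_v$ are independent, $\mathbb{E}[x_v]=\nabla$ for an unknown vector $\nabla$, and $\mathbb{E}\|x_v-\nabla\|^2\le\sigma^2$ for a known $\sigma\ge 0$. A protocol is a fixed sequence of messages, each with a prescribed sender, receiver and bit-length, whose contents depend only on the sender's input, its private randomness and the messages it has received before; finally every machine outputs a vector that depends only on its input, its private randomness and the messages it has received. There is an absolute constant $C$ such that for every $c>0$ there is a constant $K=K(c)$ such that for all $n\ge 1$, $d$, $\sigma\ge0$ and each of the three norms there are a protocol $A$ (depending on $n,d,\sigma,c$ and the norm, but not on $\nabla$ or on the distribution of the inputs), in which every machine sends and receives in total at most $K\,d\log n$ bits in every execution, and a measurable function $Z$ of the inputs and the private random sources (likewise not depending on $\nabla$ or on the distribution of the inputs), such that for every $\nabla$ and all independent inputs as above: 1. with probability at least $1-n^{-c}$ all machines output the same vector, namely $Z$; 2. $Z$ is an unbiased estimator of $\nabla$: $\mathbb{E}\|Z\|^2<\infty$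 and $\mathbb{E}[Z]=\nabla$; 3. $\mathbb{E}\|Z-\nabla\|^2\le C\big(\tfrac{\sigma^2}{n}+\mathbb{E}\|\tfrac1n\sum_v x_v-\nabla\|^2\big)$, that is, up to a constant factor and an additive $O(\sigma^2/n)$ the output variance is that of the exact average of the inputs; in particular, under the $\ell_2$-norm, $\mathbb{E}\|Z-\nabla\|^2\le C\,\tfrac{\sigma^2}{n}$. -/

import Mathlib

open MeasureTheory
open scoped ENNReal

/-- `ℝ ^ d` with the `ℓ_p` norm. -/
abbrev Vec (p : ℝ≥0∞) (d : ℕ) : Type := PiLp p fun _ : Fin d => ℝ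

/-- One message of a message-passing protocol for `n` machines with inputs in `E`.  The sender, the
receiver and the number of bits are fixed in advance, so that no information can be conveyed by
silence, by timing, by the length of a message or by the choice of its addressee.  The content may
depend on the sender's own input, on its private random source, and on the list of the messages that
it has received so far, and on nothing else. -/
structure Step (n : ℕ) (E Coin : Type) [MeasurableSpace E] [MeasurableSpace Coin] where
  src : Fin n
  dst : Fin n
  len : ℕ
  msg : E × Coin → List (List Bool) → (Fin len → Bool)
  measurable_msg : ∀ inbox : List (List Bool), Measurable fun a : E × Coin => msg a inbox

/-- A randomized message-passing protocol for `n` machines with inputs and outputs in `E`: machine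
`v` has a private random source with law `coinLaw v`, the messages in `steps` are sent one after the
other, and at the end each machine computes an output from its own input, its own random source and
the messages it has received. -/
structure Protocol (n : ℕ) (E : Type) [MeasurableSpace E] where
  Coin : Type
  [coinSpace : MeasurableSpace Coin]
  coinLaw : Fin n → Measure Coin
  [isProbabilityMeasure_coinLaw : ∀ v, IsProbabilityMeasure (coinLaw v)]
  steps : List (Step n E Coin)
  output : Fin n → E × Coin → List (List Bool) → E
  measurable_output : ∀ (v : Fin n) (inbox : List (List Bool)),
    Measurable fun a : E × Coin => output v a inbox

attribute [instance] Protocol.coinSpace Protocol.isProbabilityMeasure_coinLaw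

namespace Protocol

variable {n : ℕ} {E : Type} [MeasurableSpace E]

/-- Execution of one step on inputs `x` and random sources `w`: the message is appended to the list
of the messages received by its addressee. -/
def deliver (A : Protocol n E) (x : Fin n → E) (w : Fin n → A.Coin)
    (inbox : Fin n → List (List Bool)) (s : Step n E A.Coin) : Fin n → List (List Bool) :=
  Function.update inbox s.dst
    (inbox s.dst ++ [List.ofFn (s.msg (x s.src, w s.src) (inbox s.src))])

/-- The messages received by each machine in the whole execution. -/
def run (A : Protocol n E) (x : Fin n → E) (w : Fin n → A.Coin) : Fin n → List (List Bool) :=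
  A.steps.foldl (A.deliver x w) (fun _ => [])

/-- The value that machine `v` outputs on inputs `x` and random sources `w`. -/
def result (A : Protocol n E) (x : Fin n → E) (w : Fin n → A.Coin) (v : Fin n) : E :=
  A.output v (x v, w v) (A.run x w v)

/-- The number of bits sent and received by machine `v`; it is the same in every execution. -/
def bits (A : Protocol n E) (v : Fin n) : ℕ :=
  (A.steps.map fun s => (if s.src = v then s.len else 0) + (if s.dst = v then s.len else 0)).sum

/-- The joint law of the inputs and the random sources, when machine `v` has an input with law `D v`
and all the inputs and all the random sources are independent. -/
noncomputable def law (A : Protocol n E) (D : Fin n → Measure E) :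
    Measure ((Fin n → E) × (Fin n → A.Coin)) :=
  (Measure.pi D).prod (Measure.pi A.coinLaw)

end Protocol

/-- `D v` is the law of the input of machine `v`, which is an unbiased estimator of `nabla` with
variance at most `σ ^ 2`. -/
structure IsVRInput {n : ℕ} {E : Type} [NormedAddCommGroup E] [NormedSpace ℝ E] [MeasurableSpace E]
    (σ : ℝ) (nabla : E) (D : Fin n → Measure E) : Prop where
  isProbabilityMeasure : ∀ v, IsProbabilityMeasure (D v)
  memLp : ∀ v, MemLp (fun x : E => x) 2 (D v)
  mean : ∀ v, ∫ x, x ∂(D v) = nabla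
  variance_le : ∀ v, ∫ x, ‖x - nabla‖ ^ 2 ∂(D v) ≤ σ ^ 2

/-- `Z` is an estimator of `nabla` with finite second moment and mean `nabla`. -/
structure IsUnbiasedEstimator {Ω E : Type} [NormedAddCommGroup E] [NormedSpace ℝ E]
    [MeasurableSpace Ω] (P : Measure Ω) (Z : Ω → E) (nabla : E) : Prop where
  memLp : MemLp Z 2 P
  mean : ∫ a, Z a ∂P = nabla

/-!
Rounding each input `x v` stochastically to a grid of mesh `δ` gives an integer vector `R v` with
`E[δ R v | x v] = x v`. Hence `Z = (δ / n) ∑ v, R v` is exactly unbiased, whatever happens in the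
protocol, and with `δ` so small that each rounding error has norm at most `σ / n` its variance is at
most twice that of the exact average, plus `2 (σ / n) ^ 2` (`isUnbiasedEstimator_average`,
`integral_norm_average_sub_sq_le`).

The machines have to learn the integer vector `S = ∑ v, R v`. They compute a hash of it: a linear
map from `ℤ ^ d` to `ZMod P`. Linearity makes the hash of `S` the sum of the hashes of the `R v`, so
that it can be accumulated in `ZMod P` by a token going around a ring, and broadcast in a second
round; each machine handles four messages of `log P` bits (`ringProtocol_result`,
`ringProtocol_bits`). Machine `u` then looks for `S` near `n R u`: by Chebyshev's inequality, except
with probability `n ^ (-c)`, all inputs are within `n ^ ((c + 1) / 2) σ` of the mean, and then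
`S - n R u` has `ℓ₁`-norm at most `d r` with `r` polynomial in `n`
(`sum_abs_sum_stochRound_sub_le`). So it suffices that the hash vanishes at no nonzero integer vector
of `ℓ₁`-norm at most `2 d r`. There are at most `(16 (r + 1)) ^ d` such vectors
(`card_intL1Ball_le`), and each is killed by at most a fraction `1 / P` of the linear maps; by the
union bound a prime `P` between `(16 (r + 1)) ^ d` and twice that number is enough
(`exists_linHash`). Then `log P = O(d log n)`.

Measuring the distance in `ℓ₁`, with the mesh `δ = σ / (n d ^ (1 / p))`, treats the three norms
alike: a ball of radius `ρ σ` in the `ℓ_p`-norm contains only grid points of `ℓ₁`-norm at most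
`d n ρ` in integer coordinates, so that no factor `log d` arises.
-/

/-! ### Linear hashing of integer vectors -/

/-- The integer vectors of `ℓ₁`-norm at most `M`. -/
noncomputable def intL1Ball (d M : ℕ) : Finset (Fin d → ℤ) :=
  {a ∈ Fintype.piFinset fun _ : Fin d => Finset.Icc (-(M : ℤ)) M | ∑ i, |a i| ≤ (M : ℤ)}

lemma mem_intL1Ball {d M : ℕ} {a : Fin d → ℤ} : a ∈ intL1Ball d M ↔ ∑ i, |a i| ≤ (M : ℤ) := by
  simp only [intL1Ball, Finset.mem_filter, Fintype.mem_piFinset, Finset.mem_Icc,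
    and_iff_right_iff_imp]
  intro h i
  exact abs_le.1 ((Finset.single_le_sum (f := fun i => |a i|) (fun i _ => abs_nonneg _)
    (Finset.mem_univ i)).trans h)

lemma sum_pow_natAbs_le (r M : ℕ) :
    ∑ k ∈ Finset.Icc (-(M : ℤ)) M, ((r : ℝ) / (r + 1)) ^ k.natAbs ≤ 2 * (r + 1) := by
  set y : ℝ := (r : ℝ) / (r + 1) with hy
  have hr : (0 : ℝ) < r + 1 := by positivity
  have hy0 : 0 ≤ y := by positivity
  have hy1 : y < 1 := by rw [hy, div_lt_one hr]; linarith
  have hmaps : ∀ k ∈ Finset.Icc (-(M : ℤ)) M, k.natAbs ∈ Finset.range (M + 1) := by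
    intro k hk
    simp only [Finset.mem_Icc, Finset.mem_range] at hk ⊢
    omega
  rw [← Finset.sum_fiberwise_of_maps_to hmaps]
  calc _ ≤ ∑ m ∈ Finset.range (M + 1), 2 * y ^ m := by
        refine Finset.sum_le_sum fun m _ => ?_
        rw [Finset.sum_congr rfl (g := fun _ => y ^ m)
          (fun k hk => by rw [(Finset.mem_filter.1 hk).2]), Finset.sum_const, nsmul_eq_mul]
        refine mul_le_mul_of_nonneg_right ?_ (by positivity)
        have hsub : (Finset.Icc (-(M : ℤ)) M).filter (fun k => k.natAbs = m) ⊆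
            {(m : ℤ), -(m : ℤ)} := by
          intro k hk
          simp only [Finset.mem_filter, Finset.mem_insert, Finset.mem_singleton] at hk ⊢
          omega
        exact_mod_cast (Finset.card_le_card hsub).trans Finset.card_le_two
    _ = 2 * ∑ m ∈ Finset.range (M + 1), y ^ m := by rw [Finset.mul_sum]
    _ ≤ 2 * (1 - y)⁻¹ := by
        have := (summable_geometric_of_lt_one hy0 hy1).sum_le_tsum (Finset.range (M + 1))
          (fun _ _ => by positivity)
        rw [tsum_geometric_of_lt_one hy0 hy1] at this
        linarith
    _ = 2 * (r + 1) := by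
        have : 1 - y = (r + 1 : ℝ)⁻¹ := by rw [hy]; field_simp; ring
        rw [this, inv_inv]

/-- The number of integer vectors of `ℓ₁`-norm at most `2 d r` is exponential in `d` with a base
that is linear in `r`.  Each such vector has weight at least `exp (-2 d)` under the product weight
`a ↦ ∏ i, (r / (r + 1)) ^ |a i|`, whose total mass is at most `(2 (r + 1)) ^ d`. -/
lemma card_intL1Ball_le (d r : ℕ) (hr : 0 < r) :
    (intL1Ball d (2 * d * r)).card ≤ (16 * (r + 1)) ^ d := by
  set M := 2 * d * r
  set y : ℝ := (r : ℝ) / (r + 1) with hy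
  have hr' : (0 : ℝ) < r := by exact_mod_cast hr
  have hy0 : 0 < y := by positivity
  have hy1 : y ≤ 1 := by rw [hy, div_le_one (by positivity)]; linarith
  have hexp : Real.exp 2 ≤ 8 := by
    have h := Real.exp_one_lt_d9
    have h2 : Real.exp 2 = Real.exp 1 ^ 2 := by rw [← Real.exp_nat_mul]; norm_num
    rw [h2]
    nlinarith [Real.exp_pos 1]
  have hyM : 1 ≤ (8 : ℝ) ^ d * y ^ M := by
    have h1 : y⁻¹ ^ r ≤ Real.exp 1 := by
      have : y⁻¹ ≤ Real.exp (1 / r) := by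
        rw [hy, inv_div]
        calc ((r : ℝ) + 1) / r = 1 / r + 1 := by field_simp; ring
          _ ≤ _ := Real.add_one_le_exp _
      calc y⁻¹ ^ r ≤ Real.exp (1 / r) ^ r := by gcongr
        _ = Real.exp 1 := by rw [← Real.exp_nat_mul]; congr 1; field_simp
    have h2 : y⁻¹ ^ M ≤ 8 ^ d := by
      calc y⁻¹ ^ M = ((y⁻¹ ^ r) ^ 2) ^ d := by rw [← pow_mul, ← pow_mul]; congr 1; ring
        _ ≤ (Real.exp 1 ^ 2) ^ d := by gcongr
        _ = Real.exp 2 ^ d := by rw [← Real.exp_nat_mul]; norm_num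
        _ ≤ 8 ^ d := by gcongr
    rw [inv_pow] at h2
    have h3 : 0 < y ^ M := by positivity
    rwa [inv_le_iff_one_le_mul₀ h3] at h2
  have key : ((intL1Ball d M).card : ℝ) ≤ (16 * (r + 1)) ^ d := by
    calc ((intL1Ball d M).card : ℝ) = ∑ a ∈ intL1Ball d M, (1 : ℝ) := by simp
      _ ≤ ∑ a ∈ intL1Ball d M, 8 ^ d * ∏ i, y ^ (a i).natAbs := by
          refine Finset.sum_le_sum fun a ha => hyM.trans ?_
          rw [Finset.prod_pow_eq_pow_sum]
          have : ∑ i, (a i).natAbs ≤ M := by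
            have := mem_intL1Ball.1 ha
            zify
            exact this
          exact mul_le_mul_of_nonneg_left (pow_le_pow_of_le_one hy0.le hy1 this) (by positivity)
      _ ≤ ∑ a ∈ Fintype.piFinset fun _ : Fin d => Finset.Icc (-(M : ℤ)) M,
            8 ^ d * ∏ i, y ^ (a i).natAbs :=
          Finset.sum_le_sum_of_subset_of_nonneg (Finset.filter_subset _ _)
            fun _ _ _ => by positivity
      _ = 8 ^ d * (∑ k ∈ Finset.Icc (-(M : ℤ)) M, y ^ k.natAbs) ^ d := by
          rw [← Finset.mul_sum, ← Finset.prod_univ_sum (fun _ : Fin d => Finset.Icc (-(M : ℤ)) M)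
            fun _ k => y ^ k.natAbs]
          simp
      _ ≤ 8 ^ d * (2 * (r + 1)) ^ d := by
          have := sum_pow_natAbs_le r M
          gcongr
      _ = (16 * (r + 1)) ^ d := by rw [← mul_pow]; ring
  exact_mod_cast key

/-- The linear hash of an integer vector with coefficients `g` in `ZMod P`. -/
def linHash {d P : ℕ} (g : Fin d → ZMod P) (a : Fin d → ℤ) : ZMod P := ∑ i, g i * (a i : ZMod P)

lemma linHash_sub {d P : ℕ} (g : Fin d → ZMod P) (a b : Fin d → ℤ) :
    linHash g (a - b) = linHash g a - linHash g b := by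
  simp [linHash, mul_sub, Finset.sum_sub_distrib]

lemma linHash_sum {d P : ℕ} {ι : Type*} (s : Finset ι) (g : Fin d → ZMod P) (a : ι → Fin d → ℤ) :
    linHash g (∑ v ∈ s, a v) = ∑ v ∈ s, linHash g (a v) := by
  simp only [linHash, Finset.sum_apply, Int.cast_sum, Finset.mul_sum]
  exact Finset.sum_comm

lemma linHash_add_single {d P : ℕ} (g : Fin d → ZMod P) (a : Fin d → ℤ) (i : Fin d) (c : ZMod P) :
    linHash (g + Pi.single i c) a = linHash g a + c * (a i : ZMod P) := by
  simp [linHash, add_mul, Finset.sum_add_distrib, Pi.single_apply]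

/-- A linear hash kills a vector that is nonzero modulo `P` with probability at most `1 / P`: if it
does so with coefficients `g`, then the `P` coefficient vectors `g + c eᵢ` are all different for
different pairs `(c, g)`. -/
lemma card_linHash_eq_zero {d P : ℕ} [Fact P.Prime] (a : Fin d → ℤ) (i : Fin d)
    (hi : (a i : ZMod P) ≠ 0) :
    P * (Finset.univ.filter fun g : Fin d → ZMod P => linHash g a = 0).card ≤ P ^ d := by
  classical
  have h := Finset.card_le_card_of_injOn (s := (Finset.univ : Finset (ZMod P)) ×ˢ
    (Finset.univ.filter fun g : Fin d → ZMod P => linHash g a = 0))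
    (t := (Finset.univ : Finset (Fin d → ZMod P)))
    (fun q => q.2 + Pi.single i q.1) (fun _ _ => Finset.mem_coe.2 (Finset.mem_univ _)) ?_
  · simpa [Finset.card_product, ZMod.card] using h
  · rintro ⟨c, g⟩ hg ⟨c', g'⟩ hg' h
    simp only [Finset.coe_product, Set.mem_prod, Finset.mem_coe, Finset.mem_filter,
      Finset.mem_univ, true_and] at hg hg' h
    have h2 := congrArg (fun g => linHash g a) h
    simp only [linHash_add_single, hg, hg', zero_add] at h2
    have hc : c = c' := mul_right_cancel₀ hi h2
    subst hc
    exact Prod.ext rfl (add_right_cancel h)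

/-- By the union bound over the nonzero vectors of the ball, some linear hash modulo a prime that
exceeds the number of points of the ball vanishes at none of them. -/
lemma exists_linHash_ne_zero (d M P : ℕ) [Fact P.Prime] (hM : M < P)
    (hP : (intL1Ball d M).card ≤ P) :
    ∃ g : Fin d → ZMod P, ∀ a : Fin d → ℤ, ∑ i, |a i| ≤ (M : ℤ) → linHash g a = 0 → a = 0 := by
  classical
  by_contra! hcon
  have hP0 : 0 < P := (Fact.out : P.Prime).pos
  set B := (intL1Ball d M).erase 0
  have hcover : (Finset.univ : Finset (Fin d → ZMod P)) ⊆
      B.biUnion fun a => Finset.univ.filter fun g => linHash g a = 0 := by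
    intro g _
    obtain ⟨a, ha, h0, hne⟩ := hcon g
    simp only [Finset.mem_biUnion, Finset.mem_filter, Finset.mem_univ, true_and]
    exact ⟨a, Finset.mem_erase.2 ⟨hne, mem_intL1Ball.2 ha⟩, h0⟩
  have hfib : ∀ a ∈ B,
      P * (Finset.univ.filter fun g : Fin d → ZMod P => linHash g a = 0).card ≤ P ^ d := by
    intro a ha
    obtain ⟨hne, ha⟩ := Finset.mem_erase.1 ha
    obtain ⟨i, hi⟩ := Function.ne_iff.1 hne
    refine card_linHash_eq_zero a i fun h => hi ?_
    have hle := (Finset.single_le_sum (f := fun i => |a i|) (fun i _ => abs_nonneg _)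
      (Finset.mem_univ i)).trans (mem_intL1Ball.1 ha)
    exact Int.eq_zero_of_abs_lt_dvd ((ZMod.intCast_zmod_eq_zero_iff_dvd _ _).1 h)
      (hle.trans_lt (by exact_mod_cast hM))
  have h1 : P * P ^ d ≤ B.card * P ^ d := by
    calc P * P ^ d = P * (Finset.univ : Finset (Fin d → ZMod P)).card := by simp [ZMod.card]
      _ ≤ P * ∑ a ∈ B, (Finset.univ.filter fun g : Fin d → ZMod P => linHash g a = 0).card :=
          Nat.mul_le_mul_left _ ((Finset.card_le_card hcover).trans Finset.card_biUnion_le)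
      _ ≤ ∑ a ∈ B, P ^ d := by rw [Finset.mul_sum]; exact Finset.sum_le_sum hfib
      _ = B.card * P ^ d := by simp
  have h2 : P ≤ B.card := Nat.le_of_mul_le_mul_right h1 (by positivity)
  have h3 : B.card < (intL1Ball d M).card :=
    Finset.card_erase_lt_of_mem (mem_intL1Ball.2 (by simp))
  omega

/-- A hash that is injective on `ℓ₁`-balls of radius `d r`, with values of `O(d log r)` bits. -/
lemma exists_linHash (d r : ℕ) (hd : 0 < d) (hr : 0 < r) :
    ∃ P : ℕ, P.Prime ∧ P ≤ 2 * (16 * (r + 1)) ^ d ∧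
      ∃ g : Fin d → ZMod P, ∀ a : Fin d → ℤ,
        ∑ i, |a i| ≤ ((2 * d * r : ℕ) : ℤ) → linHash g a = 0 → a = 0 := by
  obtain ⟨P, hP, hlt, hle⟩ :=
    Nat.exists_prime_lt_and_le_two_mul ((16 * (r + 1)) ^ d) (by positivity)
  have : Fact P.Prime := ⟨hP⟩
  -- `P` has to exceed the radius, too, so that the nonzero vectors stay nonzero modulo `P`.
  refine ⟨P, hP, hle, exists_linHash_ne_zero d _ P (lt_of_le_of_lt ?_ hlt)
    ((card_intL1Ball_le d r hr).trans hlt.le)⟩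
  calc 2 * d * r ≤ 16 ^ d * (r + 1) ^ d := by
        have h1 : 2 * d ≤ 16 ^ d := by
          have := one_add_mul_le_pow (a := (15 : ℤ)) (by norm_num) d
          norm_num at this
          zify
          linarith
        have h2 : r ≤ (r + 1) ^ d :=
          (Nat.le_succ r).trans (Nat.le_self_pow hd.ne' _)
        exact Nat.mul_le_mul h1 h2
    _ = _ := by rw [mul_pow]

/-! ### Summation of group elements around a ring -/

section RingProtocol

variable {n : ℕ} {E Coin : Type} [MeasurableSpace E] [MeasurableSpace Coin]
  {I G : Type} [MeasurableSpace I] [Countable I] [MeasurableSingletonClass I] [AddCommGroup G]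
  {L : ℕ}

/-- The group element carried by the last message of an inbox, or `0` if there is none. -/
def lastValue (dec : List Bool → G) (inbox : List (List Bool)) : G :=
  (inbox.getLast?.map dec).getD 0

lemma lastValue_append (dec : List Bool → G) (inbox : List (List Bool)) (m : List Bool) :
    lastValue dec (inbox ++ [m]) = dec m := by
  simp [lastValue]

/-- Machine `k` adds a contribution that depends on its rounded input to the last value received and
passes the result on to its successor `k + 1` on the ring. -/
def ringStep [NeZero n] (R : E × Coin → I) (hR : Measurable R) (enc : G → Fin L → Bool)
    (dec : List Bool → G) (f : I → G) (k : ℕ) : Step n E Coin where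
  src := Fin.ofNat n k
  dst := Fin.ofNat n (k + 1)
  len := L
  msg a inbox := enc (lastValue dec inbox + f (R a))
  measurable_msg inbox :=
    (measurable_of_countable fun z : I => enc (lastValue dec inbox + f z)).comp hR

/-- The protocol in which a token goes twice around the ring.  In the first round each machine adds
its contribution `f`, so that the token is the total when it comes back to machine `0`; in the
second round the total is passed on unchanged. -/
def ringProtocol [NeZero n] (coinLaw : Fin n → Measure Coin) [∀ v, IsProbabilityMeasure (coinLaw v)]
    (R : E × Coin → I) (hR : Measurable R) (enc : G → Fin L → Bool) (dec : List Bool → G)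
    (f : I → G) (out : I → G → E) : Protocol n E where
  Coin := Coin
  coinLaw := coinLaw
  steps := (List.range n).map (ringStep R hR enc dec f) ++
    (List.range n).map (ringStep R hR enc dec fun _ => 0)
  output _ a inbox := out (R a) (lastValue dec inbox)
  measurable_output _ inbox :=
    (measurable_of_countable fun z : I => out z (lastValue dec inbox)).comp hR

variable [NeZero n] {coinLaw : Fin n → Measure Coin} [∀ v, IsProbabilityMeasure (coinLaw v)]
  {R : E × Coin → I} {hR : Measurable R} {enc : G → Fin L → Bool} {dec : List Bool → G}
  {f : I → G} {out : I → G → E}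

/-- Execution of one step, as in `Protocol.deliver` but with the type of the random sources made
explicit. -/
def sendStep (x : Fin n → E) (w : Fin n → Coin) (inbox : Fin n → List (List Bool))
    (s : Step n E Coin) : Fin n → List (List Bool) :=
  Function.update inbox s.dst
    (inbox s.dst ++ [List.ofFn (s.msg (x s.src, w s.src) (inbox s.src))])

lemma lastValue_sendStep_ringStep (hdec : ∀ z, dec (List.ofFn (enc z)) = z)
    (x : Fin n → E) (w : Fin n → Coin) (inbox : Fin n → List (List Bool)) (h : I → G) (k : ℕ)
    (v : Fin n) :
    lastValue dec (sendStep x w inbox (ringStep R hR enc dec h k) v) =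
      if v = Fin.ofNat n (k + 1) then
        lastValue dec (inbox (Fin.ofNat n k)) + h (R (x (Fin.ofNat n k), w (Fin.ofNat n k)))
      else lastValue dec (inbox v) := by
  unfold sendStep
  split_ifs with hv
  · subst hv
    have : (ringStep R hR enc dec h k).dst = Fin.ofNat n (k + 1) := rfl
    rw [← this, Function.update_self, lastValue_append]
    exact hdec _
  · rw [Function.update_of_ne]
    exact hv

/-- After `j` steps of the first round the token is at machine `j` modulo `n`.  For `j = n` this is
machine `0`, which holds the total. -/
lemma lastValue_first_round (hdec : ∀ z, dec (List.ofFn (enc z)) = z)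
    (x : Fin n → E) (w : Fin n → Coin) (j : ℕ) :
    lastValue dec (((List.range j).map (ringStep R hR enc dec f)).foldl
        (sendStep x w) (fun _ => []) (Fin.ofNat n j)) =
      ∑ k ∈ Finset.range j, f (R (x (Fin.ofNat n k), w (Fin.ofNat n k))) := by
  induction j with
  | zero => rfl
  | succ j ih =>
    rw [List.range_succ, List.map_append, List.foldl_append, List.map_singleton,
      List.foldl_cons, List.foldl_nil, lastValue_sendStep_ringStep hdec, if_pos rfl, ih,
      Finset.sum_range_succ]

lemma lastValue_second_round (hdec : ∀ z, dec (List.ofFn (enc z)) = z)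
    (x : Fin n → E) (w : Fin n → Coin) (inbox : Fin n → List (List Bool)) (j i : ℕ) (hi : i ≤ j) :
    lastValue dec (((List.range j).map (ringStep R hR enc dec fun _ => 0)).foldl
        (sendStep x w) inbox (Fin.ofNat n i)) =
      lastValue dec (inbox 0) := by
  induction j generalizing i with
  | zero => obtain rfl : i = 0 := by omega
            rfl
  | succ j ih =>
    rw [List.range_succ, List.map_append, List.foldl_append, List.map_singleton,
      List.foldl_cons, List.foldl_nil, lastValue_sendStep_ringStep hdec]
    split_ifs with h
    · rw [ih j le_rfl, add_zero]
    · refine ih i (by_contra fun hij => h ?_)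
      rw [show i = j + 1 by omega]

/-- Every machine learns the total of the contributions in every execution. -/
lemma ringProtocol_result (hdec : ∀ z, dec (List.ofFn (enc z)) = z)
    (x : Fin n → E) (w : Fin n → Coin) (v : Fin n) :
    (ringProtocol coinLaw R hR enc dec f out).result x w v =
      out (R (x v, w v)) (∑ u, f (R (x u, w u))) := by
  have hrun : lastValue dec ((ringProtocol coinLaw R hR enc dec f out).run x w v) =
      ∑ u, f (R (x u, w u)) := by
    have hv : v = Fin.ofNat n v := by simp
    show lastValue dec (((List.range n).map (ringStep R hR enc dec f) ++
        (List.range n).map (ringStep R hR enc dec fun _ => 0)).foldl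
          (sendStep x w) (fun _ => []) v) = _
    rw [List.foldl_append, hv, lastValue_second_round hdec _ _ _ _ _ v.2.le]
    have h := lastValue_first_round (hR := hR) (f := f) hdec x w n
    rw [← Fin.sum_univ_eq_sum_range
      (fun k => f (R (x (Fin.ofNat n k), w (Fin.ofNat n k))))] at h
    have h0 : (Fin.ofNat n n) = 0 := by ext; simp
    rw [h0] at h
    rw [h]
    simp
  show out (R (x v, w v)) (lastValue dec _) = _
  rw [hrun]

/-- In each of the two rounds every machine is sender once and receiver once. -/
lemma ringProtocol_bits (v : Fin n) :
    (ringProtocol coinLaw R hR enc dec f out).bits v = 4 * L := by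
  have key : ∀ h : I → G, (((List.range n).map (ringStep (n := n) R hR enc dec h)).map
      fun s => (if s.src = v then s.len else 0) + (if s.dst = v then s.len else 0)).sum =
        2 * L := by
    intro h
    rw [List.map_map, ← List.sum_toFinset _ List.nodup_range, List.toFinset_range,
      ← Fin.sum_univ_eq_sum_range]
    have h1 : ∀ k : Fin n, ((fun s : Step n E Coin => (if s.src = v then s.len else 0) +
        (if s.dst = v then s.len else 0)) ∘ ringStep R hR enc dec h) (k : ℕ) =
        (if k = v then L else 0) + (if k = v - 1 then L else 0) := by
      intro k
      have e1 : Fin.ofNat n (k : ℕ) = k := by simp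
      have e2 : Fin.ofNat n ((k : ℕ) + 1) = k + 1 := by ext; simp [Fin.val_add]
      simp only [Function.comp, ringStep, e1, e2, eq_sub_iff_add_eq]
    rw [Finset.sum_congr rfl fun k _ => h1 k, Finset.sum_add_distrib]
    simp [two_mul]
  show (List.map (fun s : Step n E Coin => (if s.src = v then s.len else 0) +
    (if s.dst = v then s.len else 0)) ((List.range n).map (ringStep R hR enc dec f) ++
        (List.range n).map (ringStep R hR enc dec fun _ => 0))).sum = _
  rw [List.map_append, List.sum_append, key, key]
  ring

end RingProtocol

/-! ### Averages of unbiased roundings of independent inputs -/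

section Average

variable {n : ℕ} {E Coin : Type}

lemma measurePreserving_eval_prod_eval [MeasurableSpace E] [MeasurableSpace Coin]
    (D : Fin n → Measure E) (κ : Fin n → Measure Coin)
    [∀ v, IsProbabilityMeasure (D v)] [∀ v, IsProbabilityMeasure (κ v)] (v : Fin n) :
    MeasurePreserving (fun a : (Fin n → E) × (Fin n → Coin) => (a.1 v, a.2 v))
      ((Measure.pi D).prod (Measure.pi κ)) ((D v).prod (κ v)) :=
  (measurePreserving_eval D v).prod (measurePreserving_eval κ v)

variable [NormedAddCommGroup E] [NormedSpace ℝ E]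

/-- The average of roundings with error at most `η` is within `η` of the exact average. -/
lemma norm_average_sub_le [NeZero n] {q : E × Coin → E} {η : ℝ} (hq : ∀ z, ‖q z - z.1‖ ≤ η)
    (a : (Fin n → E) × (Fin n → Coin)) :
    ‖(n : ℝ)⁻¹ • ∑ v, q (a.1 v, a.2 v) - (n : ℝ)⁻¹ • ∑ v, a.1 v‖ ≤ η := by
  have hn : (0 : ℝ) < n := by exact_mod_cast NeZero.pos n
  rw [← smul_sub, ← Finset.sum_sub_distrib, norm_smul, norm_inv, Real.norm_natCast,
    inv_mul_le_iff₀ hn]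
  calc _ ≤ ∑ v : Fin n, ‖q (a.1 v, a.2 v) - a.1 v‖ := norm_sum_le _ _
    _ ≤ ∑ v : Fin n, η := Finset.sum_le_sum fun v _ => hq _
    _ = n * η := by simp

variable [MeasurableSpace E]

lemma IsVRInput.memLp_average {σ : ℝ} {nabla : E} {D : Fin n → Measure E}
    (h : IsVRInput σ nabla D) :
    MemLp (fun x : Fin n → E => (n : ℝ)⁻¹ • ∑ v, x v) 2 (Measure.pi D) := by
  have := h.isProbabilityMeasure
  refine MemLp.const_smul (f := fun x : Fin n → E => ∑ v, x v) ?_ _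
  exact memLp_finsetSum _ fun v _ => (h.memLp v).comp_measurePreserving (measurePreserving_eval D v)

variable [MeasurableSpace Coin] [SecondCountableTopology E]

/-- Bounded rounding errors at most double the variance of the exact average, up to `2 η ^ 2`; no
independence is needed. -/
lemma integral_norm_average_sub_sq_le [NeZero n] {σ : ℝ} {nabla : E} {D : Fin n → Measure E}
    (h : IsVRInput σ nabla D) (κ : Fin n → Measure Coin) [∀ v, IsProbabilityMeasure (κ v)]
    {q : E × Coin → E} {η : ℝ} (hq : ∀ z, ‖q z - z.1‖ ≤ η) :
    ∫ a, ‖(n : ℝ)⁻¹ • ∑ v, q (a.1 v, a.2 v) - nabla‖ ^ 2 ∂((Measure.pi D).prod (Measure.pi κ)) ≤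
      2 * ∫ x, ‖(n : ℝ)⁻¹ • (∑ v, x v) - nabla‖ ^ 2 ∂(Measure.pi D) + 2 * η ^ 2 := by
  have := h.isProbabilityMeasure
  have hsq : Integrable (fun x : Fin n → E => ‖(n : ℝ)⁻¹ • (∑ v, x v) - nabla‖ ^ 2)
      (Measure.pi D) := by
    have : MemLp (fun x : Fin n → E => (n : ℝ)⁻¹ • (∑ v, x v) - nabla) 2 (Measure.pi D) :=
      h.memLp_average.sub (memLp_const nabla)
    exact this.integrable_norm_pow (by norm_num)
  have hsq' : Integrable (fun a : (Fin n → E) × (Fin n → Coin) =>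
      ‖(n : ℝ)⁻¹ • (∑ v, a.1 v) - nabla‖ ^ 2) ((Measure.pi D).prod (Measure.pi κ)) :=
    hsq.comp_fst _
  have hfst : ∫ a : (Fin n → E) × (Fin n → Coin), ‖(n : ℝ)⁻¹ • (∑ v, a.1 v) - nabla‖ ^ 2
      ∂((Measure.pi D).prod (Measure.pi κ)) =
      ∫ x, ‖(n : ℝ)⁻¹ • (∑ v, x v) - nabla‖ ^ 2 ∂(Measure.pi D) := by
    rw [integral_fun_fst fun x : Fin n → E => ‖(n : ℝ)⁻¹ • (∑ v, x v) - nabla‖ ^ 2]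
    simp
  rw [← hfst]
  have hbd : ∀ a : (Fin n → E) × (Fin n → Coin),
      ‖(n : ℝ)⁻¹ • ∑ v, q (a.1 v, a.2 v) - nabla‖ ^ 2 ≤
        2 * ‖(n : ℝ)⁻¹ • (∑ v, a.1 v) - nabla‖ ^ 2 + 2 * η ^ 2 := by
    intro a
    have h1 := norm_average_sub_le hq a
    have h2 := norm_sub_le_norm_sub_add_norm_sub ((n : ℝ)⁻¹ • ∑ v, q (a.1 v, a.2 v))
      ((n : ℝ)⁻¹ • (∑ v, a.1 v)) nabla
    have h3 := norm_nonneg ((n : ℝ)⁻¹ • ∑ v, q (a.1 v, a.2 v) - nabla)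
    nlinarith [sq_nonneg (‖(n : ℝ)⁻¹ • (∑ v, a.1 v) - nabla‖ - η)]
  calc _ ≤ ∫ a : (Fin n → E) × (Fin n → Coin),
        (2 * ‖(n : ℝ)⁻¹ • (∑ v, a.1 v) - nabla‖ ^ 2 + 2 * η ^ 2)
          ∂((Measure.pi D).prod (Measure.pi κ)) :=
        integral_mono_of_nonneg (ae_of_all _ fun _ => by positivity)
          ((hsq'.const_mul 2).add (integrable_const _)) (ae_of_all _ hbd)
    _ = _ := by
        rw [integral_add (hsq'.const_mul 2) (integrable_const _), integral_const_mul]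
        simp

variable [BorelSpace E]

/-- The average of unbiased roundings is an unbiased estimator.  Its second moment is finite because
the rounding errors are bounded. -/
lemma isUnbiasedEstimator_average [CompleteSpace E] [NeZero n] {σ : ℝ} {nabla : E}
    {D : Fin n → Measure E} (h : IsVRInput σ nabla D) (κ : Fin n → Measure Coin)
    [∀ v, IsProbabilityMeasure (κ v)]
    {q : E × Coin → E} {η : ℝ} (hqm : Measurable q) (hq : ∀ z, ‖q z - z.1‖ ≤ η)
    (hmean : ∀ v x, ∫ w, q (x, w) ∂(κ v) = x) :
    IsUnbiasedEstimator ((Measure.pi D).prod (Measure.pi κ))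
      (fun a => (n : ℝ)⁻¹ • ∑ v, q (a.1 v, a.2 v)) nabla := by
  have := h.isProbabilityMeasure
  have hn : (n : ℝ) ≠ 0 := by exact_mod_cast NeZero.ne n
  have hLq : ∀ v, MemLp q 2 ((D v).prod (κ v)) := by
    intro v
    have h1 : MemLp (fun z : E × Coin => z.1) 2 ((D v).prod (κ v)) :=
      (h.memLp v).comp_measurePreserving measurePreserving_fst
    have h2 : MemLp (fun z : E × Coin => q z - z.1) 2 ((D v).prod (κ v)) :=
      MemLp.of_bound (hqm.sub measurable_fst).aestronglyMeasurable η (ae_of_all _ hq)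
    exact (h1.add h2).ae_eq (ae_of_all _ fun z => by simp)
  have hL : ∀ v, MemLp (fun a : (Fin n → E) × (Fin n → Coin) => q (a.1 v, a.2 v)) 2
      ((Measure.pi D).prod (Measure.pi κ)) := fun v =>
    (hLq v).comp_measurePreserving (measurePreserving_eval_prod_eval D κ v)
  refine ⟨MemLp.const_smul (f := fun a : (Fin n → E) × (Fin n → Coin) => ∑ v, q (a.1 v, a.2 v))
    (memLp_finsetSum _ fun v _ => hL v) _, ?_⟩
  rw [integral_smul, integral_finsetSum _ fun v _ => (hL v).integrable (by norm_num)]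
  have hint : ∀ v, ∫ a, q (a.1 v, a.2 v) ∂((Measure.pi D).prod (Measure.pi κ)) = nabla := by
    intro v
    have hmp := measurePreserving_eval_prod_eval D κ v
    rw [← integral_map (φ := fun a : (Fin n → E) × (Fin n → Coin) => (a.1 v, a.2 v)) (f := q)
      hmp.measurable.aemeasurable hqm.aestronglyMeasurable, hmp.map_eq,
      integral_prod _ ((hLq v).integrable (by norm_num))]
    simp only [hmean]
    exact h.mean v
  simp only [hint, Finset.sum_const, Finset.card_univ, Fintype.card_fin]
  rw [← Nat.cast_smul_eq_nsmul ℝ, inv_smul_smul₀ hn]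

/-- Chebyshev's inequality and the union bound: all inputs are within `t σ` of the mean, except with
probability `n / t ^ 2`. -/
lemma one_sub_le_measureReal_norm_sub_le {σ t : ℝ} (hσ : 0 < σ) (ht : 0 < t) {nabla : E}
    {D : Fin n → Measure E} (h : IsVRInput σ nabla D) (κ : Fin n → Measure Coin)
    [∀ v, IsProbabilityMeasure (κ v)] :
    1 - n / t ^ 2 ≤ ((Measure.pi D).prod (Measure.pi κ)).real
      {a : (Fin n → E) × (Fin n → Coin) | ∀ v, ‖a.1 v - nabla‖ ≤ t * σ} := by
  have := h.isProbabilityMeasure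
  set μ := (Measure.pi D).prod (Measure.pi κ)
  have hmeas : ∀ v, MeasurableSet {a : (Fin n → E) × (Fin n → Coin) | t * σ < ‖a.1 v - nabla‖} := by
    intro v
    refine measurableSet_lt measurable_const (Measurable.norm ?_)
    exact ((measurable_pi_apply v).comp measurable_fst).sub measurable_const
  have hone : ∀ v, μ.real {a : (Fin n → E) × (Fin n → Coin) | t * σ < ‖a.1 v - nabla‖} ≤
      1 / t ^ 2 := by
    intro v
    have hmp : MeasurePreserving (fun a : (Fin n → E) × (Fin n → Coin) => a.1 v) μ (D v) :=
      (measurePreserving_eval D v).comp measurePreserving_fst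
    have hset : MeasurableSet {x : E | t * σ < ‖x - nabla‖} :=
      measurableSet_lt measurable_const (measurable_id.sub measurable_const).norm
    have heq : μ.real {a : (Fin n → E) × (Fin n → Coin) | t * σ < ‖a.1 v - nabla‖} =
        (D v).real {x : E | t * σ < ‖x - nabla‖} :=
      hmp.measureReal_preimage hset.nullMeasurableSet
    rw [heq]
    have hI : Integrable (fun x : E => ‖x - nabla‖ ^ 2) (D v) :=
      ((h.memLp v).sub (memLp_const nabla)).integrable_norm_pow (by norm_num)
    have hM := mul_meas_ge_le_integral_of_nonneg (μ := D v) (f := fun x : E => ‖x - nabla‖ ^ 2)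
      (ae_of_all _ fun _ => by positivity) hI ((t * σ) ^ 2)
    have hsub : (D v).real {x : E | t * σ < ‖x - nabla‖} ≤
        (D v).real {x : E | (t * σ) ^ 2 ≤ ‖x - nabla‖ ^ 2} := by
      refine measureReal_mono fun x (hx : t * σ < _) => ?_
      have : 0 ≤ t * σ := by positivity
      exact pow_le_pow_left₀ this hx.le 2
    rw [le_div_iff₀ (by positivity)]
    have hv := h.variance_le v
    have hσ2 : 0 < σ ^ 2 := by positivity
    refine le_of_mul_le_mul_right ?_ hσ2
    calc (D v).real {x : E | t * σ < ‖x - nabla‖} * t ^ 2 * σ ^ 2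
        = (t * σ) ^ 2 * (D v).real {x : E | t * σ < ‖x - nabla‖} := by ring
      _ ≤ (t * σ) ^ 2 * (D v).real {x : E | (t * σ) ^ 2 ≤ ‖x - nabla‖ ^ 2} := by gcongr
      _ ≤ 1 * σ ^ 2 := by linarith
  have hcompl : {a : (Fin n → E) × (Fin n → Coin) | ∀ v, ‖a.1 v - nabla‖ ≤ t * σ} =
      (⋃ v, {a : (Fin n → E) × (Fin n → Coin) | t * σ < ‖a.1 v - nabla‖})ᶜ := by
    ext a; simp
  rw [hcompl, probReal_compl_eq_one_sub (MeasurableSet.iUnion hmeas)]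
  have hU := measureReal_iUnion_fintype_le (μ := μ)
    (fun v => {a : (Fin n → E) × (Fin n → Coin) | t * σ < ‖a.1 v - nabla‖})
  have hS : ∑ v, μ.real {a : (Fin n → E) × (Fin n → Coin) | t * σ < ‖a.1 v - nabla‖} ≤ n / t ^ 2 :=
    (Finset.sum_le_sum fun v _ => hone v).trans (by simp [div_eq_mul_inv])
  linarith

end Average

/-- In the Euclidean norm the variances of independent vectors add up. -/
lemma integral_norm_average_sub_sq_le_of_two {n d : ℕ} [NeZero n] {σ : ℝ} {nabla : Vec 2 d}
    {D : Fin n → Measure (Vec 2 d)} (h : IsVRInput σ nabla D) :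
    ∫ x, ‖(n : ℝ)⁻¹ • (∑ v, x v) - nabla‖ ^ 2 ∂(Measure.pi D) ≤ σ ^ 2 / n := by
  have := h.isProbabilityMeasure
  have hn : (0 : ℝ) < n := by exact_mod_cast NeZero.pos n
  have hLi : ∀ v (i : Fin d), MemLp (fun x : Vec 2 d => x i) 2 (D v) := fun v i =>
    (PiLp.proj (𝕜 := ℝ) 2 (fun _ : Fin d => ℝ) i).comp_memLp' (h.memLp v)
  have hmean : ∀ v (i : Fin d), ∫ x, x i ∂(D v) = nabla i := fun v i => by
    have := (PiLp.proj (𝕜 := ℝ) 2 (fun _ : Fin d => ℝ) i).integral_comp_comm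
      ((h.memLp v).integrable (by norm_num))
    rw [h.mean v] at this
    exact this
  have hLd : ∀ v (i : Fin d), Integrable (fun x : Vec 2 d => (x i - nabla i) ^ 2) (D v) :=
    fun v i =>
    ((hLi v i).sub (memLp_const (nabla i))).integrable_sq
  have hvar : ∀ v, ∑ i, ProbabilityTheory.variance (fun x : Vec 2 d => x i) (D v) ≤ σ ^ 2 := by
    intro v
    refine le_trans (le_of_eq ?_) (h.variance_le v)
    simp only [EuclideanSpace.real_norm_sq_eq, PiLp.sub_apply]
    rw [integral_finsetSum _ fun i _ => hLd v i]
    refine Finset.sum_congr rfl fun i _ => ?_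
    rw [ProbabilityTheory.variance_eq_integral (hLi v i).aemeasurable, hmean]
  have hLs : ∀ i : Fin d, MemLp (∑ v : Fin n, fun x : Fin n → Vec 2 d => x v i) 2 (Measure.pi D) :=
    fun i => memLp_finsetSum' _ fun v _ =>
      (hLi v i).comp_measurePreserving (measurePreserving_eval D v)
  have hsum : ∀ i : Fin d, ∫ x, (((n : ℝ)⁻¹ • (∑ v, x v) - nabla : Vec 2 d) i) ^ 2 ∂(Measure.pi D) =
      ((n : ℝ)⁻¹) ^ 2 * ∑ v, ProbabilityTheory.variance (fun x : Vec 2 d => x i) (D v) := by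
    intro i
    rw [← ProbabilityTheory.variance_sum_pi (X := fun _ (x : Vec 2 d) => x i) fun v => hLi v i,
      ProbabilityTheory.variance_eq_integral (hLs i).aemeasurable, ← integral_const_mul]
    have hm : ∫ x, (∑ v : Fin n, fun x : Fin n → Vec 2 d => x v i) x ∂(Measure.pi D) =
        n * nabla i := by
      simp only [Finset.sum_apply]
      rw [integral_finsetSum]
      · rw [Finset.sum_congr rfl (g := fun _ => nabla i), Finset.sum_const, nsmul_eq_mul]
        · simp
        · intro v _
          rw [integral_comp_eval (μ := D) (f := fun x : Vec 2 d => x i)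
            (hLi v i).aestronglyMeasurable, hmean]
      · intro v _
        exact ((hLi v i).comp_measurePreserving (measurePreserving_eval D v)).integrable
          (by norm_num)
    rw [hm]
    refine integral_congr_ae (ae_of_all _ fun x => ?_)
    simp only [Finset.sum_apply, PiLp.sub_apply, PiLp.smul_apply, WithLp.ofLp_sum, smul_eq_mul]
    rw [← mul_pow]
    congr 1
    field_simp
  have hintg : ∀ i : Fin d, Integrable (fun x : Fin n → Vec 2 d =>
      (((n : ℝ)⁻¹ • (∑ v, x v) - nabla : Vec 2 d) i) ^ 2) (Measure.pi D) := fun i =>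
    ((PiLp.proj (𝕜 := ℝ) 2 (fun _ : Fin d => ℝ) i).comp_memLp'
      (h.memLp_average.sub (memLp_const nabla))).integrable_sq
  simp only [EuclideanSpace.real_norm_sq_eq]
  rw [integral_finsetSum _ fun i _ => hintg i]
  simp only [hsum]
  rw [← Finset.mul_sum, Finset.sum_comm]
  calc ((n : ℝ)⁻¹) ^ 2 * ∑ v, ∑ i, ProbabilityTheory.variance (fun x : Vec 2 d => x i) (D v)
      ≤ ((n : ℝ)⁻¹) ^ 2 * ∑ v : Fin n, σ ^ 2 := by gcongr; exact hvar _
    _ = σ ^ 2 / n := by simp; field_simp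

/-! ### Comparison of the norms -/

/-- For the three norms in question `s = d ^ (1 / p)` satisfies both comparisons. -/
lemma exists_norm_comparison (p : ℝ≥0∞) [Fact (1 ≤ p)] (hp : p = 1 ∨ p = 2 ∨ p = ∞) (d : ℕ)
    (hd : 0 < d) :
    ∃ s : ℝ, 0 < s ∧ (∀ (x : Vec p d) (b : ℝ), (∀ i, |x i| ≤ b) → ‖x‖ ≤ s * b) ∧
      ∀ x : Vec p d, s * ∑ i, |x i| ≤ d * ‖x‖ := by
  have hd' : (0 : ℝ) < d := by exact_mod_cast hd
  have : Nonempty (Fin d) := ⟨⟨0, hd⟩⟩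
  rcases hp with rfl | rfl | rfl
  · refine ⟨d, hd', fun x b hb => ?_, fun x => ?_⟩
    · rw [PiLp.norm_eq_of_L1]
      calc ∑ i, ‖x i‖ ≤ ∑ _i : Fin d, b := Finset.sum_le_sum fun i _ => hb i
        _ = d * b := by simp
    · rw [PiLp.norm_eq_of_L1]; rfl
  · refine ⟨√d, by positivity, fun x b hb => ?_, fun x => ?_⟩
    · have hb0 : 0 ≤ b := (abs_nonneg _).trans (hb ⟨0, hd⟩)
      rw [PiLp.norm_eq_of_L2, ← Real.sqrt_sq hb0, ← Real.sqrt_mul hd'.le]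
      refine Real.sqrt_le_sqrt ?_
      calc ∑ i, ‖x i‖ ^ 2 ≤ ∑ _i : Fin d, b ^ 2 :=
            Finset.sum_le_sum fun i _ => pow_le_pow_left₀ (norm_nonneg _) (hb i) 2
        _ = d * b ^ 2 := by simp
    · have h1 : (∑ i, |x i|) ^ 2 ≤ d * ‖x‖ ^ 2 := by
        have := sq_sum_le_card_mul_sum_sq (s := Finset.univ) (f := fun i => |x i|)
        simpa [EuclideanSpace.real_norm_sq_eq] using this
      have h2 : ∑ i, |x i| ≤ √d * ‖x‖ := by
        refine abs_le_of_sq_le_sq' ?_ (by positivity) |>.2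
        rwa [mul_pow, Real.sq_sqrt hd'.le]
      calc √d * ∑ i, |x i| ≤ √d * (√d * ‖x‖) := by gcongr
        _ = d * ‖x‖ := by rw [← mul_assoc, Real.mul_self_sqrt hd'.le]
  · refine ⟨1, one_pos, fun x b hb => ?_, fun x => ?_⟩
    · rw [PiLp.norm_eq_ciSup, one_mul]
      exact ciSup_le hb
    · rw [one_mul]
      calc ∑ i, |x i| ≤ ∑ _i : Fin d, ‖x‖ :=
            Finset.sum_le_sum fun i _ => PiLp.norm_apply_le x i
        _ = d * ‖x‖ := by simp

/-! ### Stochastic rounding to a grid -/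

/-- The point of the grid of mesh `ε` with integer coordinates `a`. -/
def gridPoint (p : ℝ≥0∞) {d : ℕ} (ε : ℝ) (a : Fin d → ℤ) : Vec p d :=
  WithLp.toLp p fun i => ε * a i

/-- Stochastic rounding to the grid of mesh `δ`: each coordinate is rounded up if the corresponding
coordinate of the random source is less than its fractional part, and down otherwise.  The value is
the vector of the integer coordinates of the grid point. -/
noncomputable def stochRound {p : ℝ≥0∞} {d : ℕ} (δ : ℝ) (z : Vec p d × (Fin d → ℝ)) : Fin d → ℤ :=
  fun i => ⌊z.1 i / δ⌋ + if z.2 i < Int.fract (z.1 i / δ) then 1 else 0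

/-- The uniform distribution on the unit cube. -/
noncomputable def cubeLaw (d : ℕ) : Measure (Fin d → ℝ) :=
  Measure.pi fun _ => volume.restrict (Set.Icc 0 1)

lemma isProbabilityMeasure_restrict_Icc :
    IsProbabilityMeasure ((volume : Measure ℝ).restrict (Set.Icc 0 1)) :=
  ⟨by simp⟩

instance (d : ℕ) : IsProbabilityMeasure (cubeLaw d) := by
  have := isProbabilityMeasure_restrict_Icc
  unfold cubeLaw
  infer_instance

section Rounding

variable {p : ℝ≥0∞} {d : ℕ}

lemma measurable_stochRound (δ : ℝ) :
    Measurable (stochRound δ : Vec p d × (Fin d → ℝ) → Fin d → ℤ) := by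
  refine measurable_pi_lambda _ fun i => ?_
  have h1 : Measurable fun z : Vec p d × (Fin d → ℝ) => z.1 i / δ :=
    by
    have h : Measurable fun z : Vec p d × (Fin d → ℝ) => z.1 i :=
      (measurable_pi_apply i).comp ((WithLp.measurable_ofLp p (Fin d → ℝ)).comp measurable_fst)
    exact h.div_const δ
  have h2 : Measurable fun z : Vec p d × (Fin d → ℝ) => z.2 i :=
    (measurable_pi_apply i).comp measurable_snd
  exact h1.floor.add (Measurable.ite (measurableSet_lt h2 h1.fract) measurable_const
    measurable_const)

lemma abs_mul_stochRound_sub_le {δ : ℝ} (hδ : 0 < δ) (z : Vec p d × (Fin d → ℝ)) (i : Fin d) :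
    |δ * stochRound δ z i - z.1 i| ≤ δ := by
  set y := z.1 i / δ with hy
  have hz : z.1 i = δ * y := by rw [hy]; field_simp
  rw [hz, ← mul_sub, abs_mul, abs_of_pos hδ]
  refine mul_le_of_le_one_right hδ.le ?_
  have h1 := Int.floor_le y
  have h2 := Int.lt_floor_add_one y
  simp only [stochRound, ← hy, Int.cast_add]
  rw [abs_le]
  split_ifs <;> push_cast <;> constructor <;> linarith

lemma integral_ite_lt_fract (y : ℝ) :
    ∫ u in Set.Icc (0 : ℝ) 1, (if u < Int.fract y then (1 : ℝ) else 0) = Int.fract y := by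
  have h0 := Int.fract_nonneg y
  have h1 := (Int.fract_lt_one y).le
  have : (fun u : ℝ => if u < Int.fract y then (1 : ℝ) else 0) =
      (Set.Iio (Int.fract y)).indicator 1 := by
    ext u; simp [Set.indicator_apply]
  rw [this, integral_indicator_one measurableSet_Iio,
    measureReal_restrict_apply measurableSet_Iio]
  have : Set.Iio (Int.fract y) ∩ Set.Icc 0 1 = Set.Ico 0 (Int.fract y) := by
    ext u
    simp only [Set.mem_inter_iff, Set.mem_Iio, Set.mem_Icc, Set.mem_Ico]
    constructor
    · rintro ⟨h, h', _⟩; exact ⟨h', h⟩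
    · rintro ⟨h, h'⟩; exact ⟨h', h, by linarith⟩
  rw [this]
  simp [h0]

lemma integral_mul_stochRound {δ : ℝ} (hδ : 0 < δ) (x : Vec p d) (i : Fin d) :
    ∫ w, δ * (stochRound δ (x, w) i : ℝ) ∂(cubeLaw d) = x i := by
  have := isProbabilityMeasure_restrict_Icc
  rw [integral_const_mul]
  have hm : Measurable fun u : ℝ => if u < Int.fract (x i / δ) then (1 : ℝ) else 0 :=
    Measurable.ite measurableSet_Iio measurable_const measurable_const
  have hi : Integrable (fun w : Fin d → ℝ => if w i < Int.fract (x i / δ) then (1 : ℝ) else 0)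
      (cubeLaw d) := by
    refine Integrable.of_bound (hm.comp (measurable_pi_apply i)).aestronglyMeasurable 1
      (ae_of_all _ fun w => ?_)
    split_ifs <;> simp
  have heq : ∫ w, (stochRound δ (x, w) i : ℝ) ∂(cubeLaw d) = x i / δ := by
    calc _ = ∫ w : Fin d → ℝ, ((⌊x i / δ⌋ : ℝ) +
          if w i < Int.fract (x i / δ) then (1 : ℝ) else 0) ∂(cubeLaw d) := by
          refine integral_congr_ae (ae_of_all _ fun w => ?_)
          simp [stochRound]
      _ = ⌊x i / δ⌋ + Int.fract (x i / δ) := by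
          rw [integral_add (integrable_const _) hi]
          congr 1
          · simp
          · exact (integral_comp_eval
              (μ := fun _ : Fin d => (volume : Measure ℝ).restrict (Set.Icc 0 1)) (i := i)
              hm.aestronglyMeasurable).trans (integral_ite_lt_fract (x i / δ))
      _ = x i / δ := Int.floor_add_fract _
  rw [heq]
  field_simp

lemma measurable_gridPoint_stochRound (ε δ : ℝ) :
    Measurable fun z : Vec p d × (Fin d → ℝ) => gridPoint p ε (stochRound δ z) :=
  (measurable_of_countable (gridPoint p ε)).comp (measurable_stochRound δ)

lemma norm_gridPoint_stochRound_sub_le [Fact (1 ≤ p)] {s δ : ℝ} (hδ : 0 < δ)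
    (hs : ∀ (x : Vec p d) (b : ℝ), (∀ i, |x i| ≤ b) → ‖x‖ ≤ s * b)
    (z : Vec p d × (Fin d → ℝ)) : ‖gridPoint p δ (stochRound δ z) - z.1‖ ≤ s * δ :=
  hs _ _ fun i => abs_mul_stochRound_sub_le hδ z i

lemma integral_gridPoint_stochRound [Fact (1 ≤ p)] {δ : ℝ} (hδ : 0 < δ) (x : Vec p d) :
    ∫ w, gridPoint p δ (stochRound δ (x, w)) ∂(cubeLaw d) = x := by
  refine PiLp.ext fun i => ?_
  rw [eval_integral_piLp]
  · exact integral_mul_stochRound hδ x i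
  intro j
  have hm : Measurable fun w => δ * (stochRound δ (x, w) j : ℝ) :=
    (measurable_of_countable fun a : Fin d → ℤ => δ * (a j : ℝ)).comp
      ((measurable_stochRound δ).comp measurable_prodMk_left)
  refine Integrable.of_bound hm.aestronglyMeasurable (δ + |x j|) (ae_of_all _ fun w => ?_)
  have h1 := abs_mul_stochRound_sub_le hδ (x, w) j
  have h2 := abs_add_le (δ * (stochRound δ (x, w) j : ℝ) - x j) (x j)
  rw [sub_add_cancel] at h2
  exact h2.trans (by simpa using h1)

end Rounding

/-! ### Decoding, and the communication bound -/

open Classical in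
/-- An integer vector at `ℓ₁`-distance at most `ρ` from `y` with hash `h`, or `0` if there is
none. -/
noncomputable def decodeNear {d P : ℕ} (g : Fin d → ZMod P) (ρ : ℕ) (y : Fin d → ℤ) (h : ZMod P) :
    Fin d → ℤ :=
  if hS : ∃ S : Fin d → ℤ, ∑ i, |S i - y i| ≤ (ρ : ℤ) ∧ linHash g S = h then hS.choose else 0

lemma decodeNear_linHash {d P ρ : ℕ} {g : Fin d → ZMod P}
    (hg : ∀ a : Fin d → ℤ, ∑ i, |a i| ≤ ((2 * ρ : ℕ) : ℤ) → linHash g a = 0 → a = 0)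
    {y S : Fin d → ℤ} (hS : ∑ i, |S i - y i| ≤ (ρ : ℤ)) :
    decodeNear g ρ y (linHash g S) = S := by
  have hex : ∃ S' : Fin d → ℤ, ∑ i, |S' i - y i| ≤ (ρ : ℤ) ∧ linHash g S' = linHash g S :=
    ⟨S, hS, rfl⟩
  rw [decodeNear, dif_pos hex]
  obtain ⟨h1, h2⟩ := hex.choose_spec
  refine sub_eq_zero.1 (hg _ ?_ (by rw [linHash_sub, h2, sub_self]))
  calc ∑ i, |(hex.choose - S) i| ≤ ∑ i, (|hex.choose i - y i| + |S i - y i|) := by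
        refine Finset.sum_le_sum fun i _ => ?_
        rw [Pi.sub_apply, abs_sub_comm (S i) (y i)]
        exact abs_sub_le _ _ _
    _ ≤ ((2 * ρ : ℕ) : ℤ) := by
        rw [Finset.sum_add_distrib]
        push_cast
        linarith

/-- The number of bits of a residue modulo `P`, when the decoding radius is polynomial in `n`. -/
lemma clog_le {n d P : ℕ} {c : ℝ} (hc : 0 < c) (hn : 2 ≤ n) (hd : 0 < d) (hP : 1 < P)
    (hle : P ≤ 2 * (16 * (⌈4 * (n : ℝ) ^ 2 * (n : ℝ) ^ ((c + 1) / 2)⌉₊ + 1)) ^ d) :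
    4 * (Nat.clog 2 P : ℝ) ≤ (4 * (11 + (c + 1) / 2) / Real.log 2) * d * Real.log n := by
  have hn' : (2 : ℝ) ≤ n := by exact_mod_cast hn
  have hn0 : (0 : ℝ) < n := by linarith
  have hd' : (1 : ℝ) ≤ d := by exact_mod_cast hd
  have hl2 : 0 < Real.log 2 := Real.log_pos (by norm_num)
  have hln : Real.log 2 ≤ Real.log n := Real.log_le_log (by norm_num) hn'
  set t := (n : ℝ) ^ ((c + 1) / 2) with ht
  have ht1 : 1 ≤ t := Real.one_le_rpow (by linarith) (by positivity)
  have hnt : 1 ≤ (n : ℝ) ^ 2 * t := by nlinarith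
  set r := ⌈4 * (n : ℝ) ^ 2 * t⌉₊
  have hr : (r : ℝ) + 1 ≤ 6 * ((n : ℝ) ^ 2 * t) := by
    have := Nat.ceil_lt_add_one (a := 4 * (n : ℝ) ^ 2 * t) (by positivity)
    change (r : ℝ) < _ at this
    linarith
  have hlr : Real.log ((r : ℝ) + 1) ≤ (5 + (c + 1) / 2) * Real.log n := by
    have h6 : Real.log 6 ≤ 3 * Real.log 2 := by
      rw [show (3 : ℝ) * Real.log 2 = Real.log (2 ^ 3) by rw [Real.log_pow]; norm_num]
      exact Real.log_le_log (by norm_num) (by norm_num)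
    calc Real.log ((r : ℝ) + 1) ≤ Real.log (6 * ((n : ℝ) ^ 2 * t)) :=
          Real.log_le_log (by positivity) hr
      _ = Real.log 6 + (2 * Real.log n + (c + 1) / 2 * Real.log n) := by
          rw [Real.log_mul (by norm_num) (by positivity), Real.log_mul (by positivity)
            (by positivity), Real.log_pow, ht, Real.log_rpow hn0]
          norm_num
      _ ≤ _ := by linarith
  have hlP : Real.log P ≤ Real.log 2 + d * (4 * Real.log 2 + Real.log ((r : ℝ) + 1)) := by
    have hle' : (P : ℝ) ≤ 2 * (2 ^ 4 * ((r : ℝ) + 1)) ^ d := by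
      norm_num
      exact_mod_cast hle
    calc Real.log P ≤ Real.log (2 * (2 ^ 4 * ((r : ℝ) + 1)) ^ d) :=
          Real.log_le_log (by exact_mod_cast hP.le) hle'
      _ = _ := by
          rw [Real.log_mul (by norm_num) (by positivity), Real.log_pow,
            Real.log_mul (by norm_num) (by positivity), Real.log_pow]
          norm_num
  have hclog : (Nat.clog 2 P : ℝ) * Real.log 2 ≤ Real.log 2 + Real.log P := by
    have h1 := Nat.pow_pred_clog_lt_self (b := 2) (by norm_num) hP
    have h2 : 0 < Nat.clog 2 P := Nat.clog_pos (by norm_num) hP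
    have h3 : ((2 : ℝ) ^ (Nat.clog 2 P - 1)) ≤ P := by exact_mod_cast h1.le
    have h4 := Real.log_le_log (by positivity) h3
    rw [Real.log_pow, Nat.cast_sub h2] at h4
    push_cast at h4
    linarith
  have hdn : Real.log n ≤ d * Real.log n := le_mul_of_one_le_left (by linarith) hd'
  have hfin : (Nat.clog 2 P : ℝ) * Real.log 2 ≤ (11 + (c + 1) / 2) * (d * Real.log n) := by
    have : (d : ℝ) * (4 * Real.log 2 + Real.log ((r : ℝ) + 1)) ≤
        d * (4 * Real.log n + (5 + (c + 1) / 2) * Real.log n) := by gcongr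
    linarith
  rw [show (4 * (11 + (c + 1) / 2) / Real.log 2) * d * Real.log n =
    4 * (11 + (c + 1) / 2) * (d * Real.log n) / Real.log 2 by ring, le_div_iff₀ hl2]
  linarith

/-! ### The protocols -/

/-- The protocol `A` solves variance reduction with failure probability at most `n ^ (-c)`: some
unbiased estimator `Z`, whose variance is within the factor `4` of the target, is with high
probability the common output of all machines. -/
def SolvesVR {n d : ℕ} {p : ℝ≥0∞} [Fact (1 ≤ p)] (σ c : ℝ) (A : Protocol n (Vec p d)) : Prop :=
  ∃ Z : (Fin n → Vec p d) × (Fin n → A.Coin) → Vec p d,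
    Measurable Z ∧
    ∀ (nabla : Vec p d) (D : Fin n → Measure (Vec p d)), IsVRInput σ nabla D →
      1 - (n : ℝ) ^ (-c) ≤ (A.law D).real {a | ∀ v : Fin n, A.result a.1 a.2 v = Z a} ∧
      IsUnbiasedEstimator (A.law D) Z nabla ∧
      ∫ a, ‖Z a - nabla‖ ^ 2 ∂(A.law D) ≤
        4 * (σ ^ 2 / n + ∫ x, ‖((n : ℝ)⁻¹ • (∑ v, x v)) - nabla‖ ^ 2 ∂(Measure.pi D)) ∧
      (p = 2 → ∫ a, ‖Z a - nabla‖ ^ 2 ∂(A.law D) ≤ 4 * (σ ^ 2 / n))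

/-- The protocol without communication in which every machine outputs its input. -/
noncomputable def silentProtocol (n : ℕ) (E : Type) [MeasurableSpace E] : Protocol n E where
  Coin := Unit
  coinLaw _ := Measure.dirac ()
  steps := []
  output _ a _ := a.1
  measurable_output _ _ := measurable_fst

/-- Without communication the problem is solved when the inputs agree almost surely (`σ = 0` or
`d = 0`) or there is only one machine. -/
lemma solvesVR_silentProtocol {n d : ℕ} {p : ℝ≥0∞} [Fact (1 ≤ p)] [NeZero n] (σ c : ℝ)
    (h : n = 1 ∨ d = 0 ∨ σ = 0) : SolvesVR σ c (silentProtocol n (Vec p d)) := by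
  refine ⟨fun a => a.1 0, (measurable_pi_apply 0).comp measurable_fst, fun nabla D hD => ?_⟩
  have := hD.isProbabilityMeasure
  change 1 - _ ≤ ((Measure.pi D).prod (Measure.pi fun _ => Measure.dirac ())).real
      {a : (Fin n → Vec p d) × (Fin n → Unit) | ∀ v : Fin n, a.1 v = a.1 0} ∧
    IsUnbiasedEstimator ((Measure.pi D).prod (Measure.pi fun _ => Measure.dirac ()))
      (fun a : (Fin n → Vec p d) × (Fin n → Unit) => a.1 0) nabla ∧
    ∫ a : (Fin n → Vec p d) × (Fin n → Unit), ‖a.1 0 - nabla‖ ^ 2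
      ∂((Measure.pi D).prod (Measure.pi fun _ => Measure.dirac ())) ≤ _ ∧
    (_ → ∫ a : (Fin n → Vec p d) × (Fin n → Unit), ‖a.1 0 - nabla‖ ^ 2
      ∂((Measure.pi D).prod (Measure.pi fun _ => Measure.dirac ())) ≤ _)
  set μ := (Measure.pi D).prod (Measure.pi fun _ : Fin n => Measure.dirac ())
  have hmp : ∀ v, MeasurePreserving (fun a : (Fin n → Vec p d) × (Fin n → Unit) => a.1 v) μ (D v) :=
    fun v => (measurePreserving_eval D v).comp measurePreserving_fst
  have hmapint : ∀ {F : Type} [NormedAddCommGroup F] [NormedSpace ℝ F] (f : Vec p d → F),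
      Continuous f → ∫ a, f (a.1 0) ∂μ = ∫ x, f x ∂(D 0) := by
    intro F _ _ f hf
    rw [← (hmp 0).map_eq, integral_map (hmp 0).measurable.aemeasurable hf.aestronglyMeasurable]
  have hvar : ∫ a, ‖a.1 0 - nabla‖ ^ 2 ∂μ ≤ σ ^ 2 / n := by
    rw [hmapint (fun x => ‖x - nabla‖ ^ 2) (by fun_prop)]
    rcases h with rfl | rfl | rfl
    · simpa using hD.variance_le 0
    · have : ∀ x : Vec p 0, ‖x - nabla‖ ^ 2 = 0 := fun x => by
        rw [Subsingleton.elim x nabla]; simp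
      simp only [this, integral_zero]
      positivity
    · simpa using hD.variance_le 0
  have havg : 0 ≤ ∫ x, ‖((n : ℝ)⁻¹ • (∑ v, x v)) - nabla‖ ^ 2 ∂(Measure.pi D) :=
    integral_nonneg fun _ => by positivity
  have hσn : 0 ≤ σ ^ 2 / n := by positivity
  refine ⟨?_, ⟨(hD.memLp 0).comp_measurePreserving (hmp 0), ?_⟩, by linarith, fun _ => by linarith⟩
  · have hae : ∀ᵐ a ∂μ, ∀ v : Fin n, a.1 v = a.1 0 := by
      rcases h with rfl | rfl | rfl
      · exact ae_of_all _ fun a v => by rw [Subsingleton.elim v 0]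
      · exact ae_of_all _ fun a v => Subsingleton.elim _ _
      · have hv : ∀ v, ∀ᵐ a ∂μ, a.1 v = nabla := by
          intro v
          refine (hmp v).quasiMeasurePreserving.ae (p := fun x => x = nabla) ?_
          have hI : Integrable (fun x : Vec p d => ‖x - nabla‖ ^ 2) (D v) :=
            ((hD.memLp v).sub (memLp_const nabla)).integrable_norm_pow (by norm_num)
          have h0 : ∫ x, ‖x - nabla‖ ^ 2 ∂(D v) = 0 :=
            le_antisymm (by simpa using hD.variance_le v) (integral_nonneg fun _ => by positivity)
          filter_upwards [(integral_eq_zero_iff_of_nonneg (fun _ => by positivity) hI).1 h0]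
            with x hx
          simpa [sub_eq_zero] using hx
        filter_upwards [ae_all_iff.2 hv] with a ha v
        rw [ha v, ha 0]
    have h1 : μ.real {a : (Fin n → Vec p d) × (Fin n → Unit) | ∀ v : Fin n, a.1 v = a.1 0} = 1 := by
      rw [measureReal_congr (t := Set.univ) (Filter.eventuallyEq_univ.2 hae), probReal_univ]
    rw [h1]
    have : (0 : ℝ) ≤ (n : ℝ) ^ (-c) := by positivity
    linarith
  · rw [hmapint (fun x => x) continuous_id]
    exact hD.mean 0

lemma gridPoint_sum {n d : ℕ} (p : ℝ≥0∞) (ε : ℝ) (a : Fin n → Fin d → ℤ) :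
    gridPoint p (ε / n) (∑ v, a v) = (n : ℝ)⁻¹ • ∑ v, gridPoint p ε (a v) := by
  refine PiLp.ext fun i => ?_
  simp only [gridPoint, Finset.sum_apply, Int.cast_sum, PiLp.smul_apply, WithLp.ofLp_sum,
    smul_eq_mul, ← Finset.mul_sum]
  ring

/-- If all inputs are within `t σ` of a common point, the sum of the roundings is close in `ℓ₁` to
`n` times the rounding of each input. -/
lemma sum_abs_sum_stochRound_sub_le {n d : ℕ} {p : ℝ≥0∞} [Fact (1 ≤ p)] [NeZero n] {s σ t : ℝ}
    (hs : 0 < s) (hσ : 0 < σ) (ht : 1 ≤ t)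
    (hs1 : ∀ (x : Vec p d) (b : ℝ), (∀ i, |x i| ≤ b) → ‖x‖ ≤ s * b)
    (hs2 : ∀ x : Vec p d, s * ∑ i, |x i| ≤ d * ‖x‖)
    (z : Fin n → Vec p d × (Fin d → ℝ)) (nabla : Vec p d)
    (hz : ∀ v, ‖(z v).1 - nabla‖ ≤ t * σ) (u : Fin n) :
    ∑ i, |(∑ v, stochRound (σ / (n * s)) (z v)) i - (n • stochRound (σ / (n * s)) (z u)) i| ≤
      ((d * ⌈4 * (n : ℝ) ^ 2 * t⌉₊ : ℕ) : ℤ) := by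
  have hn1 : (1 : ℝ) ≤ n := by exact_mod_cast NeZero.pos n
  have hn : (0 : ℝ) < n := by linarith
  set δ := σ / (n * s) with hδ
  have hδ0 : 0 < δ := by positivity
  have hsδ : s * δ = σ / n := by rw [hδ]; field_simp
  set q : Fin n → Vec p d := fun v => gridPoint p δ (stochRound δ (z v)) with hq
  have hqv : ∀ v, ‖q v - nabla‖ ≤ σ / n + t * σ := fun v => by
    have h1 := norm_gridPoint_stochRound_sub_le hδ0 hs1 (z v)
    rw [hsδ] at h1
    exact (norm_sub_le_norm_sub_add_norm_sub _ (z v).1 _).trans (add_le_add h1 (hz v))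
  set a : Fin d → ℤ := ∑ v, stochRound δ (z v) - n • stochRound δ (z u) with ha
  have hgrid : gridPoint p δ a = ∑ v, (q v - q u) := by
    refine PiLp.ext fun i => ?_
    simp only [hq, ha, gridPoint, WithLp.ofLp_sum, PiLp.sub_apply, Finset.sum_apply,
      Finset.sum_sub_distrib, Pi.sub_apply, Int.cast_sub, Int.cast_sum, Finset.mul_sum, mul_sub]
    simp
    ring
  have hnorm : ‖gridPoint p δ a‖ ≤ n * (2 * (σ / n + t * σ)) := by
    rw [hgrid]
    calc ‖∑ v, (q v - q u)‖ ≤ ∑ _v : Fin n, 2 * (σ / n + t * σ) := by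
          refine (norm_sum_le _ _).trans (Finset.sum_le_sum fun v _ => ?_)
          have h1 := norm_sub_le_norm_sub_add_norm_sub (q v) nabla (q u)
          rw [norm_sub_rev nabla] at h1
          linarith [hqv v, hqv u]
      _ = _ := by simp
  have hl1 : s * ∑ i, |(gridPoint p δ a) i| = σ / n * ((∑ i, |a i| : ℤ) : ℝ) := by
    rw [← hsδ, mul_assoc, Int.cast_sum]
    congr 1
    rw [Finset.mul_sum]
    refine Finset.sum_congr rfl fun i _ => ?_
    simp [gridPoint, abs_mul, abs_of_pos hδ0]
  have hmain : σ / n * ((∑ i, |a i| : ℤ) : ℝ) ≤ σ / n * (d * (4 * (n : ℝ) ^ 2 * t)) := by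
    rw [← hl1]
    refine (hs2 _).trans ?_
    calc (d : ℝ) * ‖gridPoint p δ a‖ ≤ d * (n * (2 * (σ / n + t * σ))) := by gcongr
      _ = σ / n * (d * (2 * n + 2 * n ^ 2 * t)) := by field_simp
      _ ≤ σ / n * (d * (4 * (n : ℝ) ^ 2 * t)) := by
          gcongr
          nlinarith
  have h2 := le_of_mul_le_mul_left hmain (by positivity)
  have h3 : ((∑ i, |a i| : ℤ) : ℝ) ≤ ((d * ⌈4 * (n : ℝ) ^ 2 * t⌉₊ : ℕ) : ℝ) := by
    push_cast
    refine le_trans (by exact_mod_cast h2) (mul_le_mul_of_nonneg_left (Nat.le_ceil _) ?_)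
    positivity
  exact_mod_cast h3

/-- The protocol that sums the hashes of the rounded inputs around a ring and decodes the sum near
the input of each machine. -/
lemma exists_solvesVR {n d : ℕ} {p : ℝ≥0∞} [Fact (1 ≤ p)] (hp : p = 1 ∨ p = 2 ∨ p = ∞) {σ c : ℝ}
    (hc : 0 < c) (hn : 2 ≤ n) (hd : 0 < d) (hσ : 0 < σ) :
    ∃ A : Protocol n (Vec p d),
      (∀ v, (A.bits v : ℝ) ≤ (4 * (11 + (c + 1) / 2) / Real.log 2) * d * Real.log n) ∧
      SolvesVR σ c A := by
  have : NeZero n := ⟨by omega⟩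
  have hn2 : (2 : ℝ) ≤ n := by exact_mod_cast hn
  have hn0 : (0 : ℝ) < n := by linarith
  set t : ℝ := (n : ℝ) ^ ((c + 1) / 2) with ht
  have ht1 : 1 ≤ t := Real.one_le_rpow (by linarith) (by positivity)
  -- The exponent of `t` is chosen so that Chebyshev's bound `n / t ^ 2` is `n ^ (-c)`.
  have ht2 : n / t ^ 2 = (n : ℝ) ^ (-c) := by
    rw [ht, ← Real.rpow_natCast, ← Real.rpow_mul hn0.le]
    nth_rewrite 1 [← Real.rpow_one (n : ℝ)]
    rw [← Real.rpow_sub hn0]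
    congr 1
    push_cast
    ring
  set r : ℕ := ⌈4 * (n : ℝ) ^ 2 * t⌉₊ with hr
  have hr0 : 0 < r := Nat.ceil_pos.2 (by positivity)
  obtain ⟨P, hPp, hPle, g, hg⟩ := exists_linHash d r hd hr0
  have : Fact P.Prime := ⟨hPp⟩
  obtain ⟨s, hs, hs1, hs2⟩ := exists_norm_comparison p hp d hd
  obtain ⟨enc⟩ : Nonempty (ZMod P ↪ (Fin (Nat.clog 2 P) → Bool)) := by
    refine Function.Embedding.nonempty_of_card_le ?_
    simpa [ZMod.card] using Nat.le_pow_clog (by norm_num) P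
  have henc : Function.Injective fun z : ZMod P => List.ofFn (enc z) :=
    List.ofFn_injective.comp enc.injective
  set dec : List Bool → ZMod P := Function.invFun fun z : ZMod P => List.ofFn (enc z) with hdec
  have hdec' : ∀ z, dec (List.ofFn (enc z)) = z := Function.leftInverse_invFun henc
  -- With this mesh the rounding error of a vector has norm at most `s δ = σ / n`.
  set δ := σ / (n * s) with hδ
  have hδ0 : 0 < δ := by positivity
  have hsδ : s * δ = σ / n := by rw [hδ]; field_simp
  set q : Vec p d × (Fin d → ℝ) → Vec p d := fun z => gridPoint p δ (stochRound δ z) with hq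
  have hqm : Measurable q := measurable_gridPoint_stochRound δ δ
  have hqη : ∀ z, ‖q z - z.1‖ ≤ σ / n := fun z =>
    (norm_gridPoint_stochRound_sub_le hδ0 hs1 z).trans_eq hsδ
  let A : Protocol n (Vec p d) := ringProtocol (fun _ => cubeLaw d) (stochRound δ)
    (measurable_stochRound δ) enc dec (linHash g)
    (fun a h => gridPoint p (δ / n) (decodeNear g (d * r) (n • a) h))
  refine ⟨A, fun v => ?_, ?_⟩
  · rw [ringProtocol_bits]
    push_cast
    exact clog_le hc hn hd hPp.one_lt hPle
  refine ⟨fun a => (n : ℝ)⁻¹ • ∑ v, q (a.1 v, a.2 v), ?_, fun nabla D hD => ?_⟩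
  · have hsum : Measurable fun a : (Fin n → Vec p d) × (Fin n → Fin d → ℝ) =>
        ∑ v, q (a.1 v, a.2 v) := Finset.measurable_sum _ fun v _ => hqm.comp
      (((measurable_pi_apply v).comp measurable_fst).prodMk
        ((measurable_pi_apply v).comp measurable_snd))
    exact hsum.const_smul (n : ℝ)⁻¹
  have hvar := integral_norm_average_sub_sq_le hD (fun _ => cubeLaw d) hqη
  have hηn : (σ / n) ^ 2 ≤ σ ^ 2 / n := by
    rw [div_pow]
    gcongr
    nlinarith
  have havg : 0 ≤ ∫ x, ‖((n : ℝ)⁻¹ • (∑ v, x v)) - nabla‖ ^ 2 ∂(Measure.pi D) :=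
    integral_nonneg fun _ => by positivity
  have hσn : 0 ≤ σ ^ 2 / n := by positivity
  refine ⟨?_, isUnbiasedEstimator_average hD (fun _ => cubeLaw d) hqm hqη
    fun _ x => integral_gridPoint_stochRound hδ0 x, hvar.trans (by linarith), ?_⟩
  · have hprob := one_sub_le_measureReal_norm_sub_le hσ (by linarith : 0 < t) hD
      (fun _ => cubeLaw d)
    rw [ht2] at hprob
    have := hD.isProbabilityMeasure
    refine hprob.trans (measureReal_mono (μ := (Measure.pi D).prod
      (Measure.pi fun _ : Fin n => cubeLaw d)) fun a ha u => ?_)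
    refine (ringProtocol_result hdec' a.1 a.2 u).trans ?_
    have hclose := sum_abs_sum_stochRound_sub_le hs hσ ht1 hs1 hs2 (fun v => (a.1 v, a.2 v)) nabla
      ha u
    rw [← linHash_sum, decodeNear_linHash (by rwa [← mul_assoc]) hclose, gridPoint_sum]
  · rintro rfl
    have h2 := integral_norm_average_sub_sq_le_of_two hD
    exact hvar.trans (by linarith)

theorem theorem3 :
    ∃ C : ℝ, 0 < C ∧ ∀ c : ℝ, 0 < c → ∃ K : ℝ, 0 < K ∧
      ∀ (p : ℝ≥0∞) [Fact (1 ≤ p)], p = 1 ∨ p = 2 ∨ p = ∞ →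
      ∀ (n d : ℕ) (σ : ℝ), 1 ≤ n → 0 ≤ σ →
      ∃ A : Protocol n (Vec p d),
        (∀ v : Fin n, (A.bits v : ℝ) ≤ K * d * Real.log n) ∧
        ∃ Z : (Fin n → Vec p d) × (Fin n → A.Coin) → Vec p d,
          Measurable Z ∧
          ∀ (nabla : Vec p d) (D : Fin n → Measure (Vec p d)), IsVRInput σ nabla D →
            1 - (n : ℝ) ^ (-c) ≤ (A.law D).real {a | ∀ v : Fin n, A.result a.1 a.2 v = Z a} ∧
            IsUnbiasedEstimator (A.law D) Z nabla ∧
            ∫ a, ‖Z a - nabla‖ ^ 2 ∂(A.law D) ≤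
              C * (σ ^ 2 / n + ∫ x, ‖((n : ℝ)⁻¹ • (∑ v, x v)) - nabla‖ ^ 2 ∂(Measure.pi D)) ∧
            (p = 2 → ∫ a, ‖Z a - nabla‖ ^ 2 ∂(A.law D) ≤ C * (σ ^ 2 / n)) := by
  have hl2 : 0 < Real.log 2 := Real.log_pos (by norm_num)
  refine ⟨4, by norm_num, fun c hc => ⟨4 * (11 + (c + 1) / 2) / Real.log 2, by positivity, ?_⟩⟩
  intro p _ hp n d σ hn hσ
  have : NeZero n := ⟨by omega⟩
  by_cases h : n = 1 ∨ d = 0 ∨ σ = 0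
  · refine ⟨silentProtocol n (Vec p d), fun v => ?_, solvesVR_silentProtocol σ c h⟩
    have h0 : (silentProtocol n (Vec p d)).bits v = 0 := rfl
    rw [h0, Nat.cast_zero]
    have : 0 ≤ Real.log n := Real.log_natCast_nonneg n
    positivity
  · push Not at h
    obtain ⟨h1, h2, h3⟩ := h
    exact exists_solvesVR hp hc (by omega) (Nat.pos_of_ne_zero h2) (lt_of_le_of_ne hσ (Ne.symm h3))
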